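/- Let $K$ be an ordered field in which every positive element is a square, and let $|\cdot|$ be an absolute value on $K$ (archimedean or not, possibly trivial; no compatibility with the order is assumed). Let $K^c$ be the completion of $(K,|\cdot|)$, $\overline{K^c}$ an algebraic closure of it with the unique extension of $|\cdot|$, and fix $\sqrt{-1}\in\overline{K^c}$. For $z\in\overline{K^c}$ algebraic over $K$ with minimal polynomial $X^d+a_{d-1}X^{d-1}+\cdots$ over $K$, put $H(z)=-a_{d-1}/d\in K$ and $V(z)=z-H(z)$. Let $f(X)=\sum_{m\ge0}a_mX^m$ have coefficients in $K$ and let $R_f\in[0,+\infty]$ be the radius of convergence of $\sum|a_m|X^m$. Let $\widehat\Omega_{f,K}$ be the set of matrices $M\in M_n(K)$ whose spectral radius (the maximum of $|\lambda|$ over the eigenvalues $\lambda$ of $M$ in $\overline{K^c}$) is $<R_f$ and all of whose eigenvalues $\lambda$ satisfy $|H(\lambda)|+|V(\lambda)|<R_f$ if $|\cdot|$ is archimedean, and $\max(|H(\lambda)|,|V(\lambda)|)<R_f$ if $|\cdot|$ is non-archimedean. For $z$ as above with $\alpha=H(z)$, $\beta=V(z)$ consider the series $$\mathbf{Re}f(z)=\sum_{m\ge0}a_m\sum_{h=0}^{\lfloor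 m/2\rfloor}\binom{m}{2h}\alpha^{m-2h}\beta^{2h},\qquad \mathbf{Im}f(z)=-\sqrt{-1}\sum_{m\ge1}a_m\sum_{h=1}^{\lfloor(m+1)/2\rfloor}\binom{m}{2h-1}\alpha^{m-2h+1}\beta^{2h-1}.$$ A normalized fine Frobenius decomposition of $M\in M_n(K)$ is an expression $$M=\sum_{i=1}^s\gamma_iA_i-\sum_{j=1}^t x_jB_j^2+\sum_{j=1}^t y_jB_j$$ with nonzero matrices $A_i,B_j\in M_n(K)$, pairwise distinct $\gamma_i\in K\setminus\{0\}$, and pairwise distinct pairs $(x_j,y_j)\in K^2$ with $y_j>0$, such that $A_iA_h=\delta_{ih}A_i$, $A_iB_j=B_jA_i=0$, $B_jB_l=0$ for $j\ne l$, and $B_j^3=-B_j$. For such a decomposition put $\lambda_j=x_j+\sqrt{-1}\,y_j$, $\overline{\lambda_j}=x_j-\sqrt{-1}\,y_j$ (so $x_j=\mathbf{Re}(\lambda_j)$, $y_j=\mathbf{Im}(\lambda_j)$), $\gamma_0=0$ and $A_0=I_n-\sum_{i=1}^sA_i+\sum_{j=1}^tB_j^2$. **Proposition.** Let $M\in\widehat\Omega_{f,K}\setminus\{0\}$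 be semisimple (diagonalizable over an algebraic closure of $K$) and suppose that every irreducible factor over $K$ of its minimal polynomial has degree at most $2$. Then $M$ has a normalized fine Frobenius decomposition. For every such decomposition, the nonzero eigenvalues of $M$ are exactly the $\gamma_i$ $(1\le i\le s)$, the $\lambda_j$ and the $\overline{\lambda_j}$; the series $f(\gamma_i)$ $(0\le i\le s)$, $\mathbf{Re}f(\lambda_j)$ and $\mathbf{Im}f(\lambda_j)$ converge to elements of $K^c$; the series $f(\lambda_j)$ converges to $\mathbf{Re}f(\lambda_j)+\sqrt{-1}\,\mathbf{Im}f(\lambda_j)$; and the series $f(M)=\sum_m a_mM^m$ converges in $M_n(K^c)$, with $$f(M)=\sum_{i=0}^sf(\gamma_i)A_i-\sum_{j=1}^t\mathbf{Re}f(\lambda_j)\,B_j^2+\sum_{j=1}^t\mathbf{Im}f(\lambda_j)\,B_j.$$ -/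

import Mathlib

open Polynomial Filter
open scoped ENNReal NNReal

noncomputable section

/-- An ordered field is *ordered quadratically closed* if every positive element is a square. -/
def IsOrderedQuadraticallyClosed (K : Type*) [Field K] [LinearOrder K] : Prop :=
  ∀ a : K, 0 < a → ∃ b : K, b ^ 2 = a

/-- The completion `K^c` of a valued field `(K, |·|)`; the absolute value is the norm of `K`. -/
abbrev ValuedCompletion (K : Type*) [NormedField K] : Type _ := UniformSpace.Completion K

/-- A fixed algebraic closure of `K^c`. The algebraic closure of `K` is the set of its elements
that are algebraic over `K`. -/
abbrev CompletionClosure (K : Type*) [NormedField K] : Type _ :=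
  AlgebraicClosure (ValuedCompletion K)

section Valued

variable {K : Type*} [NormedField K]

/-- The unique extension of the absolute value of the complete field `K^c` to its algebraic
closure: `|z| = |N(z)| ^ (1 / d)`, where `d` is the degree of `z` over `K^c` and `N(z)` is the
norm of `z` from `K^c(z)` to `K^c`, i.e. up to sign the constant term of the minimal polynomial. -/
def closureAbs (z : CompletionClosure K) : ℝ :=
  ‖(minpoly (ValuedCompletion K) z).coeff 0‖ ^
    (1 / ((minpoly (ValuedCompletion K) z).natDegree : ℝ))

/-- Convergence of the series `∑ u m` to `l` with respect to the absolute value of the algebraic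
closure of `K^c`. -/
def SeriesConvergesTo (u : ℕ → CompletionClosure K) (l : CompletionClosure K) : Prop :=
  Tendsto (fun N : ℕ => closureAbs ((∑ m ∈ Finset.range N, u m) - l)) atTop (nhds 0)

/-- The projection `H_K(z) = - a_{d-1} / d`, where `X ^ d + a_{d-1} X ^ (d-1) + ⋯` is the minimal
polynomial of `z` over `K` (used in characteristic `0`). -/
def horizontalPart (z : CompletionClosure K) : K :=
  -(minpoly K z).nextCoeff / ((minpoly K z).natDegree : K)

/-- The vertical component `V_K(z) = z - H_K(z)`. -/
def verticalPart (z : CompletionClosure K) : CompletionClosure K :=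
  z - algebraMap K (CompletionClosure K) (horizontalPart z)

/-- The radius of convergence of the real power series `∑ |a_m| X ^ m`. -/
def convRadius (f : PowerSeries K) : ℝ≥0∞ :=
  ⨆ (r : ℝ≥0) (_ : Summable fun m : ℕ => ‖PowerSeries.coeff m f‖ * (r : ℝ) ^ m), (r : ℝ≥0∞)

/-- The `m`-th term of the series `f(z) = ∑ a_m z ^ m`. -/
def powTerm (f : PowerSeries K) (z : CompletionClosure K) (m : ℕ) : CompletionClosure K :=
  algebraMap K (CompletionClosure K) (PowerSeries.coeff m f) * z ^ m

/-- The `m`-th term of the series `Re f(z)`, where `z = α + β` with `α = H_K(z)`, `β = V_K(z)`. -/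
def reTerm (f : PowerSeries K) (z : CompletionClosure K) (m : ℕ) : CompletionClosure K :=
  algebraMap K (CompletionClosure K) (PowerSeries.coeff m f) *
    ∑ h ∈ Finset.range (m / 2 + 1),
      (m.choose (2 * h) : CompletionClosure K) *
        algebraMap K (CompletionClosure K) (horizontalPart z) ^ (m - 2 * h) *
        verticalPart z ^ (2 * h)

/-- The `m`-th term of the series `Im f(z)`, with respect to the square root `I` of `-1`. -/
def imTerm (I : CompletionClosure K) (f : PowerSeries K) (z : CompletionClosure K) (m : ℕ) :
    CompletionClosure K :=
  -I * (algebraMap K (CompletionClosure K) (PowerSeries.coeff m f) *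
    ∑ h ∈ Finset.Icc 1 ((m + 1) / 2),
      (m.choose (2 * h - 1) : CompletionClosure K) *
        algebraMap K (CompletionClosure K) (horizontalPart z) ^ (m + 1 - 2 * h) *
        verticalPart z ^ (2 * h - 1))

variable {n : ℕ}

/-- The matrix `M` over `K`, seen over the completion `K^c`. -/
def toCompletion (M : Matrix (Fin n) (Fin n) K) : Matrix (Fin n) (Fin n) (ValuedCompletion K) :=
  M.map (algebraMap K (ValuedCompletion K))

/-- `z` is an eigenvalue of `M` (in the algebraic closure). -/
def IsEigenvalueOf (M : Matrix (Fin n) (Fin n) K) (z : CompletionClosure K) : Prop :=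
  Module.End.HasEigenvalue (Matrix.toLin' (M.map (algebraMap K (CompletionClosure K)))) z

/-- The spectral radius: the largest absolute value of an eigenvalue. -/
def matSpectralRadius (M : Matrix (Fin n) (Fin n) K) : ℝ≥0∞ :=
  ⨆ (z : CompletionClosure K) (_ : IsEigenvalueOf M z), ENNReal.ofReal (closureAbs z)

/-- The set `Ω_{f,K}`. -/
def OmegaSet (n : ℕ) (f : PowerSeries K) : Set (Matrix (Fin n) (Fin n) K) :=
  {M | matSpectralRadius M < convRadius f}

/-- The set `Ω̂_{f,K}`. An absolute value is archimedean if it violates the ultrametric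
inequality. -/
def OmegaHatSet (n : ℕ) (f : PowerSeries K) : Set (Matrix (Fin n) (Fin n) K) :=
  {M | M ∈ OmegaSet n f ∧ ∀ z : CompletionClosure K, IsEigenvalueOf M z →
    (¬ IsNonarchimedean (fun x : K => ‖x‖) →
      ENNReal.ofReal (‖horizontalPart z‖ + closureAbs (verticalPart z)) < convRadius f) ∧
    (IsNonarchimedean (fun x : K => ‖x‖) →
      ENNReal.ofReal (max ‖horizontalPart z‖ (closureAbs (verticalPart z))) < convRadius f)}

end Valued

/-- A matrix is semisimple if it is similar, over the algebraic closure, to a diagonal matrix. -/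
def IsSemisimpleMatrix {K : Type*} [Field K] {n : ℕ} (M : Matrix (Fin n) (Fin n) K) : Prop :=
  ∃ (P : GL (Fin n) (AlgebraicClosure K)) (d : Fin n → AlgebraicClosure K),
    M.map (algebraMap K (AlgebraicClosure K)) =
      (P : Matrix (Fin n) (Fin n) (AlgebraicClosure K)) * Matrix.diagonal d *
        ((P⁻¹ : GL (Fin n) (AlgebraicClosure K)) : Matrix (Fin n) (Fin n) (AlgebraicClosure K))

/-- The splitting bound of a polynomial over its field of coefficients: the maximum of the degrees
of its irreducible factors. -/
def polySplittingBound {K : Type*} [Field K] (p : K[X]) : ℕ :=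
  sSup {d : ℕ | ∃ q : K[X], Irreducible q ∧ q ∣ p ∧ q.natDegree = d}

/-- The splitting bound of a matrix over its field of coefficients. -/
def matSplittingBound {K : Type*} [Field K] {n : ℕ} (M : Matrix (Fin n) (Fin n) K) : ℕ :=
  polySplittingBound (minpoly K M)

/-- A normalized fine Frobenius decomposition
`M = ∑ γ_i A_i - ∑ re_j B_j ^ 2 + ∑ im_j B_j` of a matrix `M` over an ordered field. -/
structure NormalizedFineFrobenius {K : Type*} [Field K] [LinearOrder K] {n : ℕ}
    (M : Matrix (Fin n) (Fin n) K) where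
  /-- number of horizontal covariants -/
  s : ℕ
  /-- number of vertical covariants -/
  t : ℕ
  γ : Fin s → K
  A : Fin s → Matrix (Fin n) (Fin n) K
  re : Fin t → K
  im : Fin t → K
  B : Fin t → Matrix (Fin n) (Fin n) K
  γ_ne_zero : ∀ i, γ i ≠ 0
  γ_injective : Function.Injective γ
  im_pos : ∀ j, 0 < im j
  re_im_injective : Function.Injective fun j => (re j, im j)
  A_ne_zero : ∀ i, A i ≠ 0
  B_ne_zero : ∀ j, B j ≠ 0
  A_mul_self : ∀ i, A i * A i = A i
  A_mul_A : ∀ i h, i ≠ h → A i * A h = 0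
  A_mul_B : ∀ i j, A i * B j = 0
  B_mul_A : ∀ i j, B j * A i = 0
  B_mul_B : ∀ j l, j ≠ l → B j * B l = 0
  B_pow_three : ∀ j, B j ^ 3 = - B j
  decomposition : M = ∑ i, γ i • A i - ∑ j, re j • B j ^ 2 + ∑ j, im j • B j

namespace NormalizedFineFrobenius

variable {K : Type*} [Field K] [LinearOrder K] {n : ℕ} {M : Matrix (Fin n) (Fin n) K}

/-- The family `γ_0, …, γ_s` with `γ_0 = 0`. -/
def γ₀ (D : NormalizedFineFrobenius M) : Fin (D.s + 1) → K :=
  Fin.cons 0 D.γ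

/-- The family `A_0, …, A_s` with `A_0 = 1 - ∑ A_i + ∑ B_j ^ 2`. -/
def A₀ (D : NormalizedFineFrobenius M) : Fin (D.s + 1) → Matrix (Fin n) (Fin n) K :=
  Fin.cons (1 - ∑ i, D.A i + ∑ j, D.B j ^ 2) D.A

end NormalizedFineFrobenius

/-- The eigenvalue `λ_j = re_j + √-1 im_j` attached to a vertical covariant, where `I = √-1`. -/
def NormalizedFineFrobenius.eigen {K : Type*} [NormedField K] [LinearOrder K] {n : ℕ}
    {M : Matrix (Fin n) (Fin n) K} (D : NormalizedFineFrobenius M) (I : CompletionClosure K)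
    (j : Fin D.t) : CompletionClosure K :=
  algebraMap K (CompletionClosure K) (D.re j) + I * algebraMap K (CompletionClosure K) (D.im j)

/-- The conjugate `re_j - √-1 im_j`. -/
def NormalizedFineFrobenius.eigenConj {K : Type*} [NormedField K] [LinearOrder K] {n : ℕ}
    {M : Matrix (Fin n) (Fin n) K} (D : NormalizedFineFrobenius M) (I : CompletionClosure K)
    (j : Fin D.t) : CompletionClosure K :=
  algebraMap K (CompletionClosure K) (D.re j) - I * algebraMap K (CompletionClosure K) (D.im j)

end

/-! Semisimplicity makes the minimal polynomial of `M` squarefree. Since positive elements of `K`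
are squares, its irreducible factors are `X - γ` or `(X - x)² + y²` with `y > 0`. The Chinese
remainder theorem gives an idempotent `E p` for each factor `p`. The linear ones with `γ ≠ 0` are
the `A i`; for a quadratic one, `B = y⁻¹ (M - x) E p` satisfies `B² = -E p`.

In any decomposition, `-B j²` is a unit and `B j` a square root of `-1`, and `M` acts on their span
as multiplication by `x + √-1 y`. So `M ^ m` is a combination of the fixed matrices `A i`, `B j²`,
`B j`, with coefficients `γ ^ m` and the two parts of `(x + √-1 y) ^ m` (`pow_eq`). This also
determines the eigenvalues and reduces `f(M)` to finitely many scalar series. Both parts are bounded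
by `(|x| + |y|) ^ m`, or `max |x| |y| ^ m` in the ultrametric case, which the condition defining
`OmegaHatSet` controls (`summable_powParts`).

As `K` is ordered, `√-1 ∉ K`, so `H(λ) = x` and `V(λ) = √-1 y`. But `√-1` may lie in `K^c`, hence
the case distinctions for the extended absolute value. -/

/-! ### The extended absolute value on elements `a + √-1 b`. -/

section ClosureAbs

variable {K : Type*} [NormedField K]

theorem closureAbs_algebraMap (w : ValuedCompletion K) :
    closureAbs (algebraMap (ValuedCompletion K) (CompletionClosure K) w) = ‖w‖ := by
  unfold closureAbs
  rw [minpoly.eq_X_sub_C]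
  simp

/-- The minimal polynomial of `a + I b` over a field that does not contain `I = √-1`. -/
theorem minpoly_add_sqrt_neg_one_mul {F L : Type*} [Field F] [Field L] [Algebra F L] {I : L}
    (hI : I ^ 2 = -1) (hF : ∀ w : F, algebraMap F L w ≠ I) (a b : F) (hb : b ≠ 0) :
    minpoly F (algebraMap F L a + I * algebraMap F L b) = (X - C a) ^ 2 + C (b ^ 2) := by
  have hmon : ((X - C a) ^ 2 + C (b ^ 2)).Monic := by monicity!
  have hdeg : ((X - C a) ^ 2 + C (b ^ 2)).natDegree = 2 := by compute_degree!
  have hroot : aeval (algebraMap F L a + I * algebraMap F L b) ((X - C a) ^ 2 + C (b ^ 2)) = 0 := by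
    simp only [map_add, map_pow, map_sub, aeval_X, aeval_C]
    linear_combination (algebraMap F L b) ^ 2 * hI
  have hb' : algebraMap F L b ≠ 0 := by simpa using hb
  refine (minpoly.unique' F _ hmon hroot fun q hq => or_iff_not_imp_left.2 fun hq0 hq1 => ?_).symm
  have hq' : q.degree ≤ 1 := by
    have : q.natDegree < 2 := hdeg ▸ natDegree_lt_natDegree hq0 hq
    exact_mod_cast natDegree_le_iff_degree_le.1 (Nat.lt_succ_iff.1 this)
  rw [eq_X_add_C_of_degree_le_one hq'] at hq1 hq0
  generalize q.coeff 1 = c at *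
  generalize q.coeff 0 = d at *
  simp only [map_add, map_mul, aeval_C, aeval_X] at hq1
  by_cases hc : c = 0
  · subst hc
    simp at hq1 hq0
    exact hq0 hq1
  · have hc' : algebraMap F L c ≠ 0 := by simpa using hc
    -- A linear polynomial `c X + d` vanishing at `a + I b` can be solved for `I`, which would put
    -- `I` in `F`.
    apply hF (-(d + c * a) / (c * b))
    simp only [map_div₀, map_neg, map_add, map_mul]
    field_simp
    linear_combination -hq1

theorem closureAbs_add_sqrt_neg_one_mul {I : CompletionClosure K} (hI : I ^ 2 = -1)
    (hF : ∀ w : ValuedCompletion K, algebraMap _ (CompletionClosure K) w ≠ I)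
    (a b : ValuedCompletion K) :
    closureAbs (algebraMap _ (CompletionClosure K) a + I * algebraMap _ (CompletionClosure K) b)
      = ‖a ^ 2 + b ^ 2‖ ^ (1 / 2 : ℝ) := by
  by_cases hb : b = 0
  · subst hb
    rw [map_zero, mul_zero, add_zero, closureAbs_algebraMap]
    rw [← Real.sqrt_eq_rpow]
    simp [norm_pow]
  · unfold closureAbs
    rw [minpoly_add_sqrt_neg_one_mul hI hF a b hb]
    have hdeg : ((X - C a) ^ 2 + C (b ^ 2)).natDegree = 2 := by compute_degree!
    rw [hdeg]
    simp [coeff_zero_eq_eval_zero]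

theorem norm_eq_one_of_algebraMap_sq {I : CompletionClosure K} (hI : I ^ 2 = -1)
    {w : ValuedCompletion K} (hw : algebraMap _ (CompletionClosure K) w = I) : ‖w‖ = 1 := by
  have h : w ^ 2 = -1 := by
    apply (algebraMap (ValuedCompletion K) (CompletionClosure K)).injective
    rw [map_pow, hw, hI, map_neg, map_one]
  have h2 : ‖w‖ ^ 2 = 1 := by rw [← norm_pow, h, norm_neg, norm_one]
  exact (pow_eq_one_iff_of_nonneg (norm_nonneg w) two_ne_zero).1 h2

theorem closureAbs_sqrt_neg_one_mul {I : CompletionClosure K} (hI : I ^ 2 = -1)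
    (b : ValuedCompletion K) :
    closureAbs (I * algebraMap _ (CompletionClosure K) b) = ‖b‖ := by
  by_cases hF : ∀ w : ValuedCompletion K, algebraMap _ (CompletionClosure K) w ≠ I
  · have := closureAbs_add_sqrt_neg_one_mul hI hF 0 b
    rw [map_zero, zero_add] at this
    rw [this, ← Real.sqrt_eq_rpow]
    simp [norm_pow]
  · push Not at hF
    obtain ⟨w, hw⟩ := hF
    rw [← hw, ← map_mul, closureAbs_algebraMap, norm_mul, norm_eq_one_of_algebraMap_sq hI hw,
      one_mul]

/-- The explicit value of `|a + I b|` in each case replaces a triangle inequality for `closureAbs`.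
-/
theorem tendsto_closureAbs_add_sqrt_neg_one_mul {I : CompletionClosure K} (hI : I ^ 2 = -1)
    {a b : ℕ → ValuedCompletion K} (ha : Tendsto a atTop (nhds 0)) (hb : Tendsto b atTop (nhds 0)) :
    Tendsto (fun N => closureAbs (algebraMap _ (CompletionClosure K) (a N) +
      I * algebraMap _ (CompletionClosure K) (b N))) atTop (nhds 0) := by
  by_cases hF : ∀ w : ValuedCompletion K, algebraMap _ (CompletionClosure K) w ≠ I
  · simp only [closureAbs_add_sqrt_neg_one_mul hI hF]
    have h := (((ha.pow 2).add (hb.pow 2)).norm).rpow_const (p := (1 / 2 : ℝ))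
      (Or.inr (by norm_num))
    simpa using h
  · push Not at hF
    obtain ⟨w, hw⟩ := hF
    simp only [← hw, ← map_mul, ← map_add, closureAbs_algebraMap]
    have h := (ha.add (hb.const_mul w)).norm
    simpa using h

theorem seriesConvergesTo_algebraMap {u : ℕ → ValuedCompletion K} {l : ValuedCompletion K}
    (h : HasSum u l) :
    SeriesConvergesTo (fun m => algebraMap _ (CompletionClosure K) (u m))
      (algebraMap _ (CompletionClosure K) l) := by
  unfold SeriesConvergesTo
  simp only [← map_sum, ← map_sub, closureAbs_algebraMap]
  have := (h.tendsto_sum_nat.sub_const l).norm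
  simpa using this

theorem seriesConvergesTo_add_sqrt_neg_one_mul {I : CompletionClosure K} (hI : I ^ 2 = -1)
    {u v : ℕ → ValuedCompletion K} {k l : ValuedCompletion K}
    (hu : HasSum u k) (hv : HasSum v l) :
    SeriesConvergesTo (fun m => algebraMap _ (CompletionClosure K) (u m) +
        I * algebraMap _ (CompletionClosure K) (v m))
      (algebraMap _ (CompletionClosure K) k + I * algebraMap _ (CompletionClosure K) l) := by
  have h1 := hu.tendsto_sum_nat.sub_const k
  have h2 := hv.tendsto_sum_nat.sub_const l
  rw [sub_self] at h1 h2
  refine (tendsto_closureAbs_add_sqrt_neg_one_mul hI h1 h2).congr fun N => ?_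
  congr 1
  rw [Finset.sum_add_distrib, ← Finset.mul_sum, map_sub, map_sub, map_sum, map_sum]
  ring

theorem closureAbs_algebraMap_base (x : K) :
    closureAbs (algebraMap K (CompletionClosure K) x) = ‖x‖ := by
  rw [IsScalarTower.algebraMap_apply K (ValuedCompletion K) (CompletionClosure K),
    closureAbs_algebraMap]
  exact norm_algebraMap' _ x

/-- Below the supremum `R_f` there is some `r ≥ ρ` with `∑ |a_m| r ^ m` convergent; comparison with
it and completeness of `K^c` conclude. -/
theorem summable_coeff_mul {f : PowerSeries K} {ρ : ℝ} (hρ : 0 ≤ ρ)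
    (hf : ENNReal.ofReal ρ < convRadius f) {u : ℕ → K} (hu : ∀ m, ‖u m‖ ≤ ρ ^ m) :
    Summable fun m => algebraMap K (ValuedCompletion K) (PowerSeries.coeff m f * u m) := by
  unfold convRadius at hf
  simp only [lt_iSup_iff] at hf
  obtain ⟨r, hr, hlt⟩ := hf
  have hle : ρ ≤ r := by
    have := ENNReal.ofReal_le_iff_le_toReal (by simp) |>.1 hlt.le
    simpa using this
  refine Summable.of_norm_bounded hr fun m => ?_
  rw [norm_algebraMap', norm_mul]
  gcongr
  exact (hu m).trans (by gcongr)

end ClosureAbs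

/-! ### The two parts of `(x + √-1 y) ^ m`. -/

section PowParts

/-- The pair `(u, v)` with `(x + √-1 y) ^ m = u + √-1 v`. -/
def powParts {F : Type*} [CommRing F] (x y : F) : ℕ → F × F
  | 0 => (1, 0)
  | m + 1 => (x * (powParts x y m).1 - y * (powParts x y m).2,
      x * (powParts x y m).2 + y * (powParts x y m).1)

theorem add_sqrt_neg_one_mul_pow {F L : Type*} [CommRing F] [CommRing L] [Algebra F L] {I : L}
    (hI : I ^ 2 = -1) (x y : F) (m : ℕ) :
    (algebraMap F L x + I * algebraMap F L y) ^ m =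
      algebraMap F L (powParts x y m).1 + I * algebraMap F L (powParts x y m).2 := by
  induction m with
  | zero => simp [powParts]
  | succ m ih =>
    rw [pow_succ, ih, powParts]
    simp only [map_sub, map_add, map_mul]
    linear_combination algebraMap F L y * algebraMap F L (powParts x y m).2 * hI

theorem norm_powParts_le {K : Type*} [NormedField K] (x y : K) (m : ℕ) :
    ‖(powParts x y m).1‖ ≤ (‖x‖ + ‖y‖) ^ m ∧ ‖(powParts x y m).2‖ ≤ (‖x‖ + ‖y‖) ^ m := by
  induction m with
  | zero => simp [powParts]
  | succ m ih =>
    obtain ⟨h1, h2⟩ := ih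
    rw [pow_succ', add_mul]
    constructor
    · refine (norm_sub_le _ _).trans ?_
      rw [norm_mul, norm_mul]
      gcongr
    · refine (norm_add_le _ _).trans ?_
      rw [norm_mul, norm_mul]
      gcongr

theorem norm_powParts_le_of_isNonarchimedean {K : Type*} [NormedField K]
    (hna : IsNonarchimedean fun x : K => ‖x‖) (x y : K) (m : ℕ) :
    ‖(powParts x y m).1‖ ≤ max ‖x‖ ‖y‖ ^ m ∧ ‖(powParts x y m).2‖ ≤ max ‖x‖ ‖y‖ ^ m := by
  induction m with
  | zero => simp [powParts]
  | succ m ih =>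
    obtain ⟨h1, h2⟩ := ih
    have hx := le_max_left ‖x‖ ‖y‖
    have hy := le_max_right ‖x‖ ‖y‖
    rw [pow_succ']
    constructor
    · rw [powParts, sub_eq_add_neg]
      refine (hna _ _).trans (max_le ?_ ?_)
      · simp only [norm_mul]; gcongr
      · simp only [norm_neg, norm_mul]; gcongr
    · refine (hna _ _).trans (max_le ?_ ?_)
      · simp only [norm_mul]; gcongr
      · simp only [norm_mul]; gcongr

/-- In the two binomial expansions the odd powers of `b` cancel and the even ones double. -/
theorem sum_even_choose {L : Type*} [CommRing L] (a b : L) (m : ℕ) :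
    2 * ∑ h ∈ Finset.range (m / 2 + 1), (m.choose (2 * h) : L) * a ^ (m - 2 * h) * b ^ (2 * h) =
      (a + b) ^ m + (a - b) ^ m := by
  have key : ∑ h ∈ Finset.range (m / 2 + 1),
      (m.choose (2 * h) : L) * a ^ (m - 2 * h) * b ^ (2 * h) =
      ∑ k ∈ (Finset.range (m + 1)).filter Even, (m.choose k : L) * a ^ (m - k) * b ^ k := by
    refine Finset.sum_nbij (fun h => 2 * h) ?_ ?_ ?_ ?_
    · intro h hh
      simp only [Finset.mem_range, Finset.mem_filter] at *
      exact ⟨by omega, by simp⟩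
    · intro h _ k _ hk
      simpa using hk
    · intro k hk
      simp only [Finset.coe_filter, Finset.mem_range, Set.mem_ofPred_eq] at hk
      obtain ⟨hk, r, rfl⟩ := hk
      exact ⟨r, by simp; omega, by simp; omega⟩
    · intros; rfl
  rw [key, Finset.sum_filter, add_comm a b, sub_eq_neg_add, add_pow, add_pow,
    ← Finset.sum_add_distrib, Finset.mul_sum]
  refine Finset.sum_congr rfl fun k _ => ?_
  split_ifs with hk
  · rw [hk.neg_pow]; ring
  · rw [(Nat.not_even_iff_odd.1 hk).neg_pow]; ring

/-- The exponent is written `m + 1 - 2 * h` because `m - 2 * h + 1` would truncate to `1` instead of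
`0` at the last index when `m` is odd. -/
theorem sum_odd_choose {L : Type*} [CommRing L] (a b : L) (m : ℕ) :
    2 * ∑ h ∈ Finset.Icc 1 ((m + 1) / 2),
      (m.choose (2 * h - 1) : L) * a ^ (m + 1 - 2 * h) * b ^ (2 * h - 1) =
      (a + b) ^ m - (a - b) ^ m := by
  have key : ∑ h ∈ Finset.Icc 1 ((m + 1) / 2),
      (m.choose (2 * h - 1) : L) * a ^ (m + 1 - 2 * h) * b ^ (2 * h - 1) =
      ∑ k ∈ (Finset.range (m + 1)).filter Odd, (m.choose k : L) * a ^ (m - k) * b ^ k := by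
    refine Finset.sum_nbij (fun h => 2 * h - 1) ?_ ?_ ?_ ?_
    · intro h hh
      simp only [Finset.mem_Icc, Finset.mem_range, Finset.mem_filter] at *
      exact ⟨by omega, h - 1, by omega⟩
    · intro h hh k hk hk'
      simp only [Finset.coe_Icc, Set.mem_Icc] at *
      omega
    · intro k hk
      simp only [Finset.coe_filter, Finset.mem_range, Set.mem_ofPred_eq] at hk
      obtain ⟨hk, r, rfl⟩ := hk
      refine ⟨r + 1, ?_, ?_⟩
      · simp only [Finset.coe_Icc, Set.mem_Icc]; omega
      · simp only; omega
    · intro h hh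
      simp only [Finset.mem_Icc] at hh
      rw [show m - (2 * h - 1) = m + 1 - 2 * h by omega]
  rw [key, Finset.sum_filter, add_comm a b, (by ring : a - b = -b + a), add_pow, add_pow,
    ← Finset.sum_sub_distrib, Finset.mul_sum]
  refine Finset.sum_congr rfl fun k _ => ?_
  split_ifs with hk
  · rw [hk.neg_pow]; ring
  · rw [(Nat.not_odd_iff_even.1 hk).neg_pow]; ring

end PowParts

/-! ### The terms of `f(λ)`, `Re f(λ)` and `Im f(λ)`. -/

section Terms

variable {K : Type*} [NormedField K] {I : CompletionClosure K} {x y : K}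

/-- The minimal polynomial is taken over `K`, so only `I ∉ K` matters; its coefficient of `X` is
`-2x`. -/
theorem horizontalPart_add_sqrt_neg_one_mul [CharZero K] (hI : I ^ 2 = -1)
    (hF : ∀ w : K, algebraMap K (CompletionClosure K) w ≠ I) (hy : y ≠ 0) :
    horizontalPart (algebraMap K (CompletionClosure K) x +
      I * algebraMap K (CompletionClosure K) y) = x := by
  have hdeg : ((X - C x) ^ 2 + C (y ^ 2)).natDegree = 2 := by compute_degree!
  unfold horizontalPart
  rw [minpoly_add_sqrt_neg_one_mul hI hF x y hy, nextCoeff_of_natDegree_pos (by omega), hdeg]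
  have : (X - C x) ^ 2 + C (y ^ 2) = X ^ 2 - C (2 * x) * X + C (x ^ 2 + y ^ 2) := by
    simp only [map_add, map_mul, map_pow, map_ofNat]
    ring
  rw [this]
  generalize x ^ 2 + y ^ 2 = c
  simp [coeff_X_pow, coeff_C]

theorem verticalPart_add_sqrt_neg_one_mul [CharZero K] (hI : I ^ 2 = -1)
    (hF : ∀ w : K, algebraMap K (CompletionClosure K) w ≠ I) (hy : y ≠ 0) :
    verticalPart (algebraMap K (CompletionClosure K) x +
      I * algebraMap K (CompletionClosure K) y) = I * algebraMap K (CompletionClosure K) y := by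
  unfold verticalPart
  rw [horizontalPart_add_sqrt_neg_one_mul hI hF hy]
  ring

theorem powTerm_add_sqrt_neg_one_mul (hI : I ^ 2 = -1) (f : PowerSeries K) (m : ℕ) :
    powTerm f (algebraMap K (CompletionClosure K) x +
      I * algebraMap K (CompletionClosure K) y) m =
    algebraMap K (CompletionClosure K) (PowerSeries.coeff m f * (powParts x y m).1) +
      I * algebraMap K (CompletionClosure K) (PowerSeries.coeff m f * (powParts x y m).2) := by
  unfold powTerm
  rw [add_sqrt_neg_one_mul_pow hI, map_mul, map_mul]
  ring

theorem reTerm_add_sqrt_neg_one_mul [CharZero K] (hI : I ^ 2 = -1)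
    (hF : ∀ w : K, algebraMap K (CompletionClosure K) w ≠ I) (hy : y ≠ 0)
    (f : PowerSeries K) (m : ℕ) :
    reTerm f (algebraMap K (CompletionClosure K) x +
      I * algebraMap K (CompletionClosure K) y) m =
    algebraMap K (CompletionClosure K) (PowerSeries.coeff m f * (powParts x y m).1) := by
  have : CharZero (CompletionClosure K) := charZero_of_injective_algebraMap
    (algebraMap K (CompletionClosure K)).injective
  unfold reTerm
  rw [horizontalPart_add_sqrt_neg_one_mul hI hF hy, verticalPart_add_sqrt_neg_one_mul hI hF hy,
    map_mul]
  congr 1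
  apply mul_left_cancel₀ (two_ne_zero' (CompletionClosure K))
  -- The conjugate has the same `powParts`, with `-I` as the square root; hence the sum of the two
  -- powers is twice the first part.
  have hI' : (-I) ^ 2 = -1 := by rw [neg_sq, hI]
  rw [sum_even_choose, sub_eq_add_neg, ← neg_mul, add_sqrt_neg_one_mul_pow hI,
    add_sqrt_neg_one_mul_pow hI']
  ring

theorem imTerm_add_sqrt_neg_one_mul [CharZero K] (hI : I ^ 2 = -1)
    (hF : ∀ w : K, algebraMap K (CompletionClosure K) w ≠ I) (hy : y ≠ 0)
    (f : PowerSeries K) (m : ℕ) :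
    imTerm I f (algebraMap K (CompletionClosure K) x +
      I * algebraMap K (CompletionClosure K) y) m =
    algebraMap K (CompletionClosure K) (PowerSeries.coeff m f * (powParts x y m).2) := by
  have : CharZero (CompletionClosure K) := charZero_of_injective_algebraMap
    (algebraMap K (CompletionClosure K)).injective
  unfold imTerm
  rw [horizontalPart_add_sqrt_neg_one_mul hI hF hy, verticalPart_add_sqrt_neg_one_mul hI hF hy,
    map_mul]
  apply mul_left_cancel₀ (two_ne_zero' (CompletionClosure K))
  have hI' : (-I) ^ 2 = -1 := by rw [neg_sq, hI]
  have h := sum_odd_choose (algebraMap K (CompletionClosure K) x)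
    (I * algebraMap K (CompletionClosure K) y) m
  rw [sub_eq_add_neg (algebraMap K (CompletionClosure K) x), ← neg_mul,
    add_sqrt_neg_one_mul_pow hI, add_sqrt_neg_one_mul_pow hI'] at h
  -- The difference of the two powers is `2 I` times the second part, and `-I * I = 1`.
  linear_combination (-I * algebraMap K (CompletionClosure K) (PowerSeries.coeff m f)) * h -
    2 * algebraMap K (CompletionClosure K) (PowerSeries.coeff m f) *
      algebraMap K (CompletionClosure K) (powParts x y m).2 * hI

end Terms

theorem algebraMap_ne_sqrt_neg_one {F L : Type*} [Field F] [LinearOrder F] [IsStrictOrderedRing F]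
    [Field L] [Algebra F L] {I : L} (hI : I ^ 2 = -1) (w : F) : algebraMap F L w ≠ I := by
  intro hw
  have h : w ^ 2 = -1 := by
    apply (algebraMap F L).injective
    rw [map_pow, hw, hI, map_neg, map_one]
  nlinarith [sq_nonneg w]

/-! ### Eigenvalues and eigenvectors. -/

section Eigenvalues

variable {K : Type*} [NormedField K] {n : ℕ} {M : Matrix (Fin n) (Fin n) K}

theorem isEigenvalueOf_iff {z : CompletionClosure K} :
    IsEigenvalueOf M z ↔
      ∃ v, v ≠ 0 ∧ (M.map (algebraMap K (CompletionClosure K))).mulVec v = z • v := by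
  unfold IsEigenvalueOf
  constructor
  · intro h
    obtain ⟨v, hv⟩ := h.exists_hasEigenvector
    exact ⟨v, hv.2, by simpa using hv.apply_eq_smul⟩
  · rintro ⟨v, hv, h⟩
    refine Module.End.hasEigenvalue_of_hasEigenvector (x := v) ⟨?_, hv⟩
    rw [Module.End.mem_eigenspace_iff]
    simpa using h

/-- Any nonzero column of `N` is an eigenvector. -/
theorem isEigenvalueOf_of_mul_eq {z : CompletionClosure K}
    {N : Matrix (Fin n) (Fin n) (CompletionClosure K)} (hN : N ≠ 0)
    (h : M.map (algebraMap K (CompletionClosure K)) * N = z • N) : IsEigenvalueOf M z := by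
  rw [isEigenvalueOf_iff]
  by_contra! hc
  apply hN
  ext a b
  by_contra hab
  refine hc (N.col b) (fun h0 => hab (congrFun h0 a)) ?_
  ext c
  exact congrFun (congrFun h c) b

end Eigenvalues

/-! ### Multiplication rules, powers and eigenvalues of a decomposed matrix. -/

namespace NormalizedFineFrobenius

section Products

variable {K : Type*} [Field K] [LinearOrder K] {n : ℕ} {M : Matrix (Fin n) (Fin n) K}
  (D : NormalizedFineFrobenius M)

theorem A_mul_eq_ite (i h : Fin D.s) : D.A i * D.A h = if i = h then D.A h else 0 := by
  split_ifs with e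
  · rw [e, D.A_mul_self]
  · exact D.A_mul_A i h e

theorem B_mul_eq_ite (j l : Fin D.t) : D.B j * D.B l = if j = l then D.B l ^ 2 else 0 := by
  split_ifs with e
  · rw [e, sq]
  · exact D.B_mul_B j l e

theorem sq_B_mul (j l : Fin D.t) : D.B j ^ 2 * D.B l = if j = l then -D.B l else 0 := by
  split_ifs with e
  · rw [e, ← pow_succ, D.B_pow_three]
  · rw [sq, mul_assoc, D.B_mul_B j l e, mul_zero]

theorem B_mul_sq (j l : Fin D.t) : D.B j * D.B l ^ 2 = if j = l then -D.B l else 0 := by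
  split_ifs with e
  · rw [e, ← pow_succ', D.B_pow_three]
  · rw [sq, ← mul_assoc, D.B_mul_B j l e, zero_mul]

theorem mul_A (i : Fin D.s) : M * D.A i = D.γ i • D.A i := by
  conv_lhs => enter [1]; rw [D.decomposition]
  simp [sub_mul, add_mul, Finset.sum_mul, D.A_mul_eq_ite, D.B_mul_A, sq, mul_assoc]

theorem A_mul (i : Fin D.s) : D.A i * M = D.γ i • D.A i := by
  conv_lhs => enter [2]; rw [D.decomposition]
  simp [mul_sub, mul_add, Finset.mul_sum, D.A_mul_eq_ite, D.A_mul_B, sq, ← mul_assoc]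

/-- With `-B²` read as `1` and `B` as `√-1`, this is `(x + √-1 y) √-1 = x √-1 - y`. -/
theorem mul_B (j : Fin D.t) : M * D.B j = D.re j • D.B j + D.im j • D.B j ^ 2 := by
  conv_lhs => enter [1]; rw [D.decomposition]
  simp [sub_mul, add_mul, Finset.sum_mul, D.B_mul_eq_ite, D.sq_B_mul, D.A_mul_B]

theorem B_mul (j : Fin D.t) : D.B j * M = D.re j • D.B j + D.im j • D.B j ^ 2 := by
  conv_lhs => enter [2]; rw [D.decomposition]
  simp [mul_sub, mul_add, Finset.mul_sum, D.B_mul_eq_ite, D.B_mul_sq, D.B_mul_A]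

theorem mul_B_sq (j : Fin D.t) : M * D.B j ^ 2 = D.re j • D.B j ^ 2 - D.im j • D.B j := by
  rw [sq, ← mul_assoc, D.mul_B, add_mul, smul_mul_assoc, smul_mul_assoc, ← pow_succ,
    D.B_pow_three, smul_neg, sub_eq_add_neg]

theorem B_sq_mul (j : Fin D.t) : D.B j ^ 2 * M = D.re j • D.B j ^ 2 - D.im j • D.B j := by
  rw [sq, mul_assoc, D.B_mul, mul_add, mul_smul_comm, mul_smul_comm, ← pow_succ',
    D.B_pow_three, smul_neg, sub_eq_add_neg]

theorem mul_one_sub : M * (1 - ∑ i, D.A i + ∑ j, D.B j ^ 2) = 0 := by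
  rw [mul_add, mul_sub, mul_one, Finset.mul_sum, Finset.mul_sum]
  simp only [D.mul_A, D.mul_B_sq, Finset.sum_sub_distrib]
  conv_lhs => enter [1, 1]; rw [D.decomposition]
  abel

theorem mul_A₀ (i : Fin (D.s + 1)) : M * D.A₀ i = D.γ₀ i • D.A₀ i := by
  cases i using Fin.cases with
  | zero => simpa [A₀, γ₀] using D.mul_one_sub
  | succ i => simpa [A₀, γ₀] using D.mul_A i

/-- For `m = 0` the idempotents `A₀ i` and `-B j²` sum to `1`, using `0 ^ 0 = 1` for `γ_0`. Each
further factor `M` acts summand by summand, through the recursion of `powParts`. -/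
theorem pow_eq (m : ℕ) :
    M ^ m = ∑ i, D.γ₀ i ^ m • D.A₀ i - ∑ j, (powParts (D.re j) (D.im j) m).1 • D.B j ^ 2
      + ∑ j, (powParts (D.re j) (D.im j) m).2 • D.B j := by
  induction m with
  | zero =>
    simp only [pow_zero, one_smul, powParts, zero_smul, Finset.sum_const_zero, add_zero,
      Fin.sum_univ_succ, A₀, Fin.cons_zero, Fin.cons_succ]
    abel
  | succ m ih =>
    rw [pow_succ', ih, mul_add, mul_sub, Finset.mul_sum, Finset.mul_sum, Finset.mul_sum,
      sub_add, sub_add, ← Finset.sum_sub_distrib, ← Finset.sum_sub_distrib]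
    congr 1
    · refine Finset.sum_congr rfl fun i _ => ?_
      rw [mul_smul_comm, D.mul_A₀, smul_smul, pow_succ]
    · refine Finset.sum_congr rfl fun j _ => ?_
      rw [mul_smul_comm, mul_smul_comm, D.mul_B, D.mul_B_sq, powParts]
      module

end Products

section Eigenvalues

variable {K : Type*} [NormedField K] [LinearOrder K] {n : ℕ} {M : Matrix (Fin n) (Fin n) K}
  (D : NormalizedFineFrobenius M)

theorem isEigenvalueOf_γ (i : Fin D.s) :
    IsEigenvalueOf M (algebraMap K (CompletionClosure K) (D.γ i)) := by
  refine isEigenvalueOf_of_mul_eq (N := (D.A i).map (algebraMap K (CompletionClosure K))) ?_ ?_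
  · rw [Ne, ← Matrix.map_zero (algebraMap K (CompletionClosure K)) (map_zero _)]
    exact fun h => D.A_ne_zero i (Matrix.map_injective (algebraMap K _).injective h)
  · rw [← Matrix.map_mul, D.mul_A]
    ext a b
    simp

theorem isEigenvalueOf_eigen [IsStrictOrderedRing K] {I : CompletionClosure K}
    (hI : I ^ 2 = -1) (j : Fin D.t) : IsEigenvalueOf M (D.eigen I j) := by
  set φ := algebraMap K (CompletionClosure K) with hφ
  refine isEigenvalueOf_of_mul_eq (N := (D.B j ^ 2).map φ + I • (D.B j).map φ) ?_ ?_
  · intro h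
    obtain ⟨a, b, hab⟩ : ∃ a b, D.B j a b ≠ 0 := by
      by_contra! hc
      exact D.B_ne_zero j (by ext a b; exact hc a b)
    have hab' : φ (D.B j a b) ≠ 0 := by simpa using hab
    have h1 : φ ((D.B j ^ 2) a b) + I * φ (D.B j a b) = 0 := congrFun (congrFun h a) b
    -- If `B² + I B` vanished at an entry where `B` does not, `I` would be a quotient of elements of
    -- `K`.
    apply algebraMap_ne_sqrt_neg_one hI (-((D.B j ^ 2) a b) / D.B j a b)
    rw [← hφ, map_div₀, map_neg]
    field_simp
    linear_combination -h1
  · rw [mul_add, mul_smul_comm, ← Matrix.map_mul, ← Matrix.map_mul, D.mul_B, D.mul_B_sq]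
    ext a b
    simp only [eigen, ← hφ, Matrix.add_apply, Matrix.sub_apply, Matrix.smul_apply,
      Matrix.map_apply, smul_eq_mul, map_add, map_sub, map_mul]
    linear_combination -(φ (D.im j) * φ (D.B j a b)) * hI

theorem eigenConj_eq (I : CompletionClosure K) (j : Fin D.t) :
    D.eigenConj I j = D.eigen (-I) j := by
  simp [eigen, eigenConj, sub_eq_add_neg]

/-- An eigenvector for any other `z` is killed by all `A i` and `B j`, hence by `M`, which forces `z
= 0`. -/
theorem eq_of_isEigenvalueOf {I : CompletionClosure K} (hI : I ^ 2 = -1)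
    {z : CompletionClosure K} (hz0 : z ≠ 0) (hz : IsEigenvalueOf M z) :
    (∃ i, z = algebraMap K (CompletionClosure K) (D.γ i)) ∨
      (∃ j, z = D.eigen I j ∨ z = D.eigenConj I j) := by
  obtain ⟨v, hv, h⟩ := isEigenvalueOf_iff.1 hz
  by_contra! hc
  obtain ⟨hγ, hB⟩ := hc
  set φ := algebraMap K (CompletionClosure K) with hφ
  have hA0 : ∀ i, ((D.A i).map φ).mulVec v = 0 := by
    intro i
    have e : (D.A i * M).map φ = φ (D.γ i) • (D.A i).map φ := by
      rw [D.A_mul]; ext a b; simp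
    have e2 := congrArg (fun N => N.mulVec v) e
    simp only [Matrix.map_mul, ← Matrix.mulVec_mulVec, h, Matrix.mulVec_smul,
      Matrix.smul_mulVec] at e2
    rw [← sub_eq_zero, ← sub_smul] at e2
    exact (smul_eq_zero.1 e2).resolve_left (sub_ne_zero.2 (hγ i))
  have hB0 : ∀ j, ((D.B j).map φ).mulVec v = 0 := by
    intro j
    have e : (D.B j * M).map φ = φ (D.re j) • (D.B j).map φ + φ (D.im j) • (D.B j ^ 2).map φ := by
      rw [D.B_mul]; ext a b; simp
    have e' : (D.B j ^ 2 * M).map φ =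
        φ (D.re j) • (D.B j ^ 2).map φ - φ (D.im j) • (D.B j).map φ := by
      rw [D.B_sq_mul]; ext a b; simp
    have e2 := congrArg (fun N => N.mulVec v) e
    have e3 := congrArg (fun N => N.mulVec v) e'
    simp only [Matrix.map_mul, ← Matrix.mulVec_mulVec, h, Matrix.mulVec_smul,
      Matrix.smul_mulVec, Matrix.add_mulVec, Matrix.sub_mulVec] at e2 e3
    generalize ((D.B j).map φ).mulVec v = p at *
    generalize ((D.B j ^ 2).map φ).mulVec v = q at *
    -- Eliminate `q` from `(z - x) p = y q` and `(z - x) q = -y p`.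
    have e4 : ((z - D.eigen I j) * (z - D.eigenConj I j)) • p = 0 := by
      have : (z - D.eigen I j) * (z - D.eigenConj I j) =
          (z - φ (D.re j)) ^ 2 + φ (D.im j) ^ 2 := by
        simp only [eigen, eigenConj, ← hφ]
        linear_combination -φ (D.im j) ^ 2 * hI
      rw [this]
      ext a
      have e2' := congrFun e2 a
      have e3' := congrFun e3 a
      simp only [Pi.smul_apply, Pi.add_apply, Pi.sub_apply, Pi.zero_apply, smul_eq_mul] at *
      linear_combination (z - φ (D.re j)) * e2' + φ (D.im j) * e3'
    exact (smul_eq_zero.1 e4).resolve_left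
      (mul_ne_zero (sub_ne_zero.2 (hB j).1) (sub_ne_zero.2 (hB j).2))
  have hM0 : (M.map φ).mulVec v = 0 := by
    have e : M.map φ = ∑ i, φ (D.γ i) • (D.A i).map φ
        - ∑ j, φ (D.re j) • ((D.B j).map φ * (D.B j).map φ) + ∑ j, φ (D.im j) • (D.B j).map φ := by
      conv_lhs => rw [D.decomposition]
      ext a b
      simp [Matrix.sum_apply, sq, ← Matrix.map_mul]
    rw [e]
    simp [Matrix.add_mulVec, Matrix.sub_mulVec, Matrix.sum_mulVec, Matrix.smul_mulVec, hA0, hB0,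
      ← Matrix.mulVec_mulVec]
  rw [h] at hM0
  exact (smul_eq_zero.1 hM0).elim hz0 hv

theorem isEigenvalueOf_iff_eq [IsStrictOrderedRing K] {I : CompletionClosure K}
    (hI : I ^ 2 = -1) {z : CompletionClosure K} (hz0 : z ≠ 0) :
    IsEigenvalueOf M z ↔ (∃ i, z = algebraMap K (CompletionClosure K) (D.γ i)) ∨
      (∃ j, z = D.eigen I j ∨ z = D.eigenConj I j) := by
  refine ⟨D.eq_of_isEigenvalueOf hI hz0, ?_⟩
  rintro (⟨i, rfl⟩ | ⟨j, rfl | rfl⟩)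
  · exact D.isEigenvalueOf_γ i
  · exact D.isEigenvalueOf_eigen hI j
  · rw [D.eigenConj_eq]
    exact D.isEigenvalueOf_eigen (by rw [neg_sq, hI]) j

end Eigenvalues

end NormalizedFineFrobenius

/-! ### Existence of a decomposition. -/

section Existence

/-- Over the algebraic closure, polynomials in `M` are simultaneously conjugate to diagonal
matrices, which form a reduced ring. -/
theorem IsSemisimpleMatrix.eq_zero_of_aeval_pow {K : Type*} [Field K] {n : ℕ}
    {M : Matrix (Fin n) (Fin n) K} (h : IsSemisimpleMatrix M) (q : K[X]) (k : ℕ)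
    (hq : aeval M q ^ k = 0) : aeval M q = 0 := by
  obtain ⟨P, d, hP⟩ := h
  let Φ : Matrix (Fin n) (Fin n) K →ₐ[K] Matrix (Fin n) (Fin n) (AlgebraicClosure K) :=
    (Algebra.ofId K (AlgebraicClosure K)).mapMatrix
  have hΦ : Function.Injective Φ :=
    Matrix.map_injective (algebraMap K (AlgebraicClosure K)).injective
  let Ψ : (Fin n → AlgebraicClosure K) →ₐ[K] Matrix (Fin n) (Fin n) (AlgebraicClosure K) :=
    Matrix.diagonalAlgHom K
  let c := MulSemiringAction.toAlgEquiv K (Matrix (Fin n) (Fin n) (AlgebraicClosure K))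
    (ConjAct.toConjAct P)
  have hc : Φ M = c (Ψ d) := by
    rw [MulSemiringAction.toAlgEquiv_apply, ConjAct.units_smul_def]
    exact hP
  have key : Φ (aeval M q) = c (Ψ (aeval d q)) := by
    rw [← aeval_algHom_apply, hc, ← aeval_algHom_apply]
    exact aeval_algHom_apply c.toAlgHom (Ψ d) q
  have h0 : aeval d q ^ k = 0 := by
    apply Matrix.diagonal_injective
    apply c.injective
    have := congrArg Φ hq
    rw [map_pow, key, map_zero, ← map_pow, ← map_pow] at this
    rw [Matrix.diagonal_zero', map_zero]
    exact this
  apply hΦ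
  rw [key, eq_zero_of_pow_eq_zero h0]
  simp

theorem IsSemisimpleMatrix.squarefree_minpoly {K : Type*} [Field K] {n : ℕ}
    {M : Matrix (Fin n) (Fin n) K} (h : IsSemisimpleMatrix M) : Squarefree (minpoly K M) := by
  have hr : IsRadical (minpoly K M) := by
    intro k q hq
    apply minpoly.dvd
    apply h.eq_zero_of_aeval_pow q k
    obtain ⟨r, hr⟩ := hq
    rw [← map_pow, hr, map_mul, minpoly.aeval, zero_mul]
  exact hr.squarefree (minpoly.ne_zero (Matrix.isIntegral M))

theorem natDegree_le_of_matSplittingBound_le {K : Type*} [Field K] {n d : ℕ}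
    {M : Matrix (Fin n) (Fin n) K} (h : matSplittingBound M ≤ d) {q : K[X]} (hq : Irreducible q)
    (hdvd : q ∣ minpoly K M) : q.natDegree ≤ d := by
  refine le_trans (b := matSplittingBound M) (le_csSup ?_ ⟨q, hq, hdvd, rfl⟩) h
  -- The supremum in `ℕ` dominates the set only once it is known to be bounded.
  refine ⟨(minpoly K M).natDegree, ?_⟩
  rintro _ ⟨p, -, hp, rfl⟩
  exact natDegree_le_of_dvd hp (minpoly.ne_zero (Matrix.isIntegral M))

/-- A monic irreducible polynomial of degree at most `2` over an ordered quadratically closed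
field is linear or of the form `(X - x) ^ 2 + y ^ 2` with `0 < y`. -/
theorem IsOrderedQuadraticallyClosed.eq_of_irreducible {K : Type*} [Field K] [LinearOrder K]
    [IsStrictOrderedRing K] (hK : IsOrderedQuadraticallyClosed K) {p : K[X]} (hp : Irreducible p)
    (hmon : p.Monic) (hdeg : p.natDegree ≤ 2) :
    (∃ γ, p = X - C γ) ∨ ∃ x y, 0 < y ∧ p = (X - C x) ^ 2 + C (y ^ 2) := by
  have hpos := hp.natDegree_pos
  obtain h1 | h2 : p.natDegree = 1 ∨ p.natDegree = 2 := by omega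
  · left
    refine ⟨-p.coeff 0, ?_⟩
    rw [map_neg, sub_neg_eq_add]
    exact hmon.eq_X_add_C h1
  · right
    have hp2 : p = X ^ 2 + C (p.coeff 1) * X + C (p.coeff 0) := by
      conv_lhs => rw [p.as_sum_range_C_mul_X_pow, h2]
      have hl : p.coeff 2 = 1 := by rw [← h2]; exact hmon
      simp [Finset.sum_range_succ, hl]
      ring
    generalize p.coeff 1 = b at hp2
    generalize p.coeff 0 = c at hp2
    have hsq : p = (X - C (-b / 2)) ^ 2 + C (c - (b / 2) ^ 2) := by
      have : (C b : K[X]) = 2 * C (b / 2) := by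
        rw [← C_ofNat, ← C_mul]; congr 1; ring
      rw [hp2, neg_div, map_neg, map_sub, map_pow, this]
      ring
    by_cases hpos : 0 < c - (b / 2) ^ 2
    · obtain ⟨y, hy⟩ := hK _ hpos
      have hy0 : y ≠ 0 := by rintro rfl; simp at hy; linarith
      exact ⟨-b / 2, |y|, abs_pos.2 hy0, by rw [hsq, sq_abs, hy]⟩
    -- Otherwise the negated constant is a square and `p` has a root; zero is treated apart because
    -- `hK` covers only positive elements.
    · exfalso
      obtain ⟨y, hy⟩ : ∃ y, y ^ 2 = -(c - (b / 2) ^ 2) := by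
        rcases (not_lt.1 hpos).lt_or_eq with h | h
        · exact hK _ (by linarith)
        · exact ⟨0, by rw [h]; simp⟩
      have hroot : p.IsRoot (-b / 2 + y) := by
        rw [hsq, IsRoot.def]
        simp only [eval_add, eval_pow, eval_sub, eval_X, eval_C]
        linear_combination hy
      have : p.natDegree = 1 :=
        natDegree_eq_of_degree_eq_some (degree_eq_one_of_irreducible_of_root hp hroot)
      omega

/-- The spectral idempotents attached to a factorization of the minimal polynomial into pairwise
coprime factors. -/
theorem exists_spectral_idempotents {K R : Type*} [Field K] [Ring R] [Algebra K R] (a : R)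
    (S : Finset K[X]) (hS : ∏ p ∈ S, p = minpoly K a)
    (hcop : (S : Set K[X]).Pairwise IsCoprime) (hu : ∀ p ∈ S, ¬ IsUnit p) :
    ∃ E : K[X] → R, (∀ p ∈ S, E p * E p = E p) ∧
      (∀ p ∈ S, ∀ q ∈ S, p ≠ q → E p * E q = 0) ∧ ∑ p ∈ S, E p = 1 ∧
      (∀ p ∈ S, aeval a p * E p = 0) ∧ (∀ p ∈ S, E p ≠ 0) ∧ ∀ p, Commute a (E p) := by
  classical
  -- Chinese remainder: `e p` is `1` modulo `p` and `0` modulo the other factors, from a Bézout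
  -- relation. Outside `S` its value is irrelevant.
  have hex : ∀ p : K[X], ∃ e : K[X], p ∈ S → p ∣ 1 - e ∧ ∏ q ∈ S.erase p, q ∣ e := by
    intro p
    by_cases hp : p ∈ S
    · obtain ⟨u, v, huv⟩ : IsCoprime p (∏ q ∈ S.erase p, q) :=
        IsCoprime.prod_right fun q hq =>
          hcop hp (Finset.mem_of_mem_erase hq) (Finset.ne_of_mem_erase hq).symm
      exact ⟨v * ∏ q ∈ S.erase p, q, fun _ =>
        ⟨⟨u, by linear_combination -huv⟩, dvd_mul_left _ _⟩⟩
    · exact ⟨0, fun h => absurd h hp⟩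
  choose e he using hex
  have hmul : ∀ p ∈ S, p * ∏ q ∈ S.erase p, q = minpoly K a := fun p hp => by
    rw [Finset.mul_prod_erase S (fun q => q) hp, hS]
  have hdvd : ∀ p ∈ S, ∀ q ∈ S, p ≠ q → p ∣ e q := fun p hp q hq hpq =>
    (Finset.dvd_prod_of_mem (fun q => q) (Finset.mem_erase.2 ⟨hpq, hp⟩)).trans (he q hq).2
  refine ⟨fun p => aeval a (e p), fun p hp => ?_, fun p hp q hq hpq => ?_, ?_, fun p hp => ?_,
    fun p hp h0 => ?_, fun p => ?_⟩
  · rw [← map_mul, eq_comm, ← sub_eq_zero, ← map_sub, ← minpoly.dvd_iff, ← hmul p hp,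
      show e p - e p * e p = (1 - e p) * e p by ring]
    exact mul_dvd_mul (he p hp).1 (he p hp).2
  · rw [← map_mul, ← minpoly.dvd_iff, ← hmul p hp, mul_comm (e p)]
    exact mul_dvd_mul (hdvd p hp q hq hpq) (he p hp).2
  · rw [← map_sum, eq_comm, ← sub_eq_zero, ← map_one (aeval (R := K) a), ← map_sub,
      ← minpoly.dvd_iff, ← hS]
    refine Finset.prod_dvd_of_coprime hcop fun p hp => ?_
    rw [← Finset.add_sum_erase S e hp, ← sub_sub]
    exact dvd_sub (he p hp).1 (Finset.dvd_sum fun q hq =>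
      hdvd p hp q (Finset.mem_of_mem_erase hq) (Finset.ne_of_mem_erase hq).symm)
  · rw [← map_mul, ← minpoly.dvd_iff, ← hmul p hp]
    exact mul_dvd_mul_left _ (he p hp).2
  -- If `e p` killed `a`, then `p` would divide both `e p` and `1 - e p`.
  · refine hu p hp (isUnit_of_dvd_one ?_)
    have h1 : p ∣ e p := (Dvd.intro _ (hmul p hp)).trans (minpoly.dvd_iff.2 h0)
    simpa using dvd_add (he p hp).1 h1
  · have := congrArg (aeval a) (mul_comm X (e p))
    rwa [map_mul, map_mul, aeval_X] at this

/-- The distinct monic irreducible factors of a squarefree monic polynomial. -/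
theorem exists_finset_prod_eq_of_squarefree {K : Type*} [Field K] {μ : K[X]} (hμ : μ.Monic)
    (hsq : Squarefree μ) : ∃ S : Finset K[X], ∏ p ∈ S, p = μ ∧ ∀ p ∈ S, Irreducible p ∧ p.Monic := by
  classical
  open UniqueFactorizationMonoid in
  refine ⟨⟨normalizedFactors μ, (squarefree_iff_nodup_normalizedFactors hμ.ne_zero).1 hsq⟩, ?_,
    fun p hp => ?_⟩
  · rw [Finset.prod_mk, Multiset.map_id', prod_normalizedFactors_eq, hμ.normalize_eq_self]
    exact hμ.ne_zero
  · obtain ⟨h1, h2, -⟩ := (Polynomial.mem_normalizedFactors_iff hμ.ne_zero).1 hp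
    exact ⟨h1, h2⟩

theorem nonempty_normalizedFineFrobenius {K : Type*} [Field K] [LinearOrder K]
    [IsStrictOrderedRing K] (hK : IsOrderedQuadraticallyClosed K) {n : ℕ}
    {M : Matrix (Fin n) (Fin n) K} (hss : IsSemisimpleMatrix M) (hsb : matSplittingBound M ≤ 2) :
    Nonempty (NormalizedFineFrobenius M) := by
  classical
  obtain ⟨S, hS, hS'⟩ := exists_finset_prod_eq_of_squarefree
    (minpoly.monic (Matrix.isIntegral M)) hss.squarefree_minpoly
  have hcop : (S : Set K[X]).Pairwise IsCoprime := fun p hp q hq hpq =>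
    (hS' p hp).1.coprime_iff_not_dvd.2 fun h => hpq
      (eq_of_monic_of_associated (hS' p hp).2 (hS' q hq).2
        ((hS' p hp).1.associated_of_dvd (hS' q hq).1 h))
  obtain ⟨E, hE, hEE, hE1, hEp, hE0, hEc⟩ := exists_spectral_idempotents M S hS hcop
    fun p hp => (hS' p hp).1.not_isUnit
  have hclass : ∀ p ∈ S, (∃ γ, p = X - C γ) ∨ ∃ x y, 0 < y ∧ p = (X - C x) ^ 2 + C (y ^ 2) :=
    fun p hp => hK.eq_of_irreducible (hS' p hp).1 (hS' p hp).2
      (natDegree_le_of_matSplittingBound_le hsb (hS' p hp).1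
        (hS ▸ Finset.dvd_prod_of_mem (fun p => p) hp))
  have hdeg : ∀ {γ x y : K}, X - C γ ≠ (X - C x) ^ 2 + C (y ^ 2) := by
    intro γ x y h
    have h2 : ((X - C x) ^ 2 + C (y ^ 2)).natDegree = 2 := by compute_degree!
    rw [← h, natDegree_X_sub_C] at h2
    omega
  have hlin : ∀ {γ : K}, X - C γ ∈ S → M * E (X - C γ) = γ • E (X - C γ) := by
    intro γ h
    have := hEp _ h
    simpa [sub_mul, sub_eq_zero, Algebra.algebraMap_eq_smul_one] using this
  have hquad : ∀ {x y : K} {p : K[X]}, p ∈ S → p = (X - C x) ^ 2 + C (y ^ 2) →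
      (M - x • 1) * ((M - x • 1) * E p) = -(y ^ 2 • E p) := by
    intro x y p hp h
    have := hEp p hp
    conv at this => enter [1, 1]; rw [h]
    simp only [map_add, map_pow, map_sub, aeval_X, aeval_C, Algebra.algebraMap_eq_smul_one,
      add_mul, _root_.smul_pow, one_pow, smul_mul_assoc, one_mul] at this
    rw [← mul_assoc, ← sq, eq_neg_iff_add_eq_zero, this]
  -- The factor `X`, if present, is left out: it contributes `M * E X = 0`.
  let S₁ := S.filter fun p => ∃ γ, γ ≠ 0 ∧ p = X - C γ
  let S₂ := S.filter fun p => ∃ x y, 0 < y ∧ p = (X - C x) ^ 2 + C (y ^ 2)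
  have h₁ : ∀ p : S₁, ∃ γ, γ ≠ 0 ∧ p.1 = X - C γ := fun p => (Finset.mem_filter.1 p.2).2
  have h₂ : ∀ p : S₂, ∃ x y, 0 < y ∧ p.1 = (X - C x) ^ 2 + C (y ^ 2) :=
    fun p => (Finset.mem_filter.1 p.2).2
  choose γ hγ0 hγ using h₁
  choose x y hy hxy using h₂
  have hm₁ : ∀ p : S₁, p.1 ∈ S := fun p => (Finset.mem_filter.1 p.2).1
  have hm₂ : ∀ p : S₂, p.1 ∈ S := fun p => (Finset.mem_filter.1 p.2).1
  -- On the range of `E p` one has `(M - x)² = -y²`, so dividing `M - x` by `y` gives a square root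
  -- of `-1` there.
  let B : S₂ → Matrix (Fin n) (Fin n) K := fun p => (y p)⁻¹ • ((M - x p • 1) * E p)
  have hcomm : ∀ (p : K[X]) (c : K), E p * (M - c • 1) = (M - c • 1) * E p := fun p c => by
    rw [mul_sub, sub_mul, (hEc p).eq]
    simp
  have hBE : ∀ p : S₂, E p * B p = B p := fun p => by
    simp only [B]
    rw [mul_smul_comm, ← mul_assoc, hcomm, mul_assoc, hE _ (hm₂ p)]
  have hBB : ∀ p : S₂, B p ^ 2 = -E p := fun p => by
    have hy0 := (hy p).ne'
    simp only [B]
    rw [sq, smul_mul_smul_comm, mul_assoc, ← mul_assoc (E p), hcomm, mul_assoc _ (E p),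
      hE _ (hm₂ p), hquad (hm₂ p) (hxy p), smul_neg, smul_smul]
    congr 1
    convert one_smul K (E p) using 2
    field_simp
  have hEB : ∀ (q : K[X]) (p : S₂), q ∈ S → q ≠ p → E q * B p = 0 := fun q p hq hqp => by
    simp only [B]
    rw [mul_smul_comm, ← mul_assoc, hcomm, mul_assoc, hEE q hq p (hm₂ p) hqp, mul_zero, smul_zero]
  have hBE' : ∀ (q : K[X]) (p : S₂), q ∈ S → q ≠ p → B p * E q = 0 := fun q p hq hqp => by
    simp only [B]
    rw [smul_mul_assoc, mul_assoc, hEE p (hm₂ p) q hq hqp.symm, mul_zero, smul_zero]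
  have hne : ∀ (p : S₁) (q : S₂), p.1 ≠ q.1 := fun p q h => by
    rw [hγ p, hxy q] at h
    exact hdeg h
  have hMB : ∀ p : S₂, M * E p = -(x p • B p ^ 2) + y p • B p := fun p => by
    rw [hBB, smul_neg, neg_neg]
    simp only [B]
    rw [smul_smul, mul_inv_cancel₀ (hy p).ne', one_smul, sub_mul, smul_mul_assoc, one_mul,
      add_sub_cancel]
  -- Expand `M = ∑ M * E p` and sort the factors by type; the types are disjoint by degree.
  have hsum : M = ∑ p : S₁, γ p • E p + ∑ p : S₂, (-(x p • B p ^ 2) + y p • B p) := by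
    have e1 : ∑ p : S₁, γ p • E p = ∑ p ∈ S₁, M * E p := by
      rw [← Finset.sum_coe_sort S₁]
      refine Finset.sum_congr rfl fun p _ => ?_
      have := hlin (γ := γ p) (hγ p ▸ hm₁ p)
      rw [← hγ p] at this
      exact this.symm
    have e2 : ∑ p : S₂, (-(x p • B p ^ 2) + y p • B p) = ∑ p ∈ S₂, M * E p := by
      rw [← Finset.sum_coe_sort S₂]
      exact Finset.sum_congr rfl fun p _ => (hMB p).symm
    rw [e1, e2, Finset.sum_filter, Finset.sum_filter, ← Finset.sum_add_distrib]
    conv_lhs => rw [← mul_one M, ← hE1, Finset.mul_sum]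
    refine Finset.sum_congr rfl fun p hp => ?_
    rcases hclass p hp with ⟨c, rfl⟩ | hq
    · rw [if_neg (c := ∃ x y, 0 < y ∧ X - C c = (X - C x) ^ 2 + C (y ^ 2))
        fun ⟨u, v, _, h⟩ => hdeg h, add_zero]
      split_ifs with h
      · rfl
      · have hc : c = 0 := by
          by_contra hc
          exact h ⟨c, hc, rfl⟩
        rw [hlin hp, hc, zero_smul]
    · rw [if_pos hq, if_neg, zero_add]
      rintro ⟨c, -, rfl⟩
      obtain ⟨u, v, _, h⟩ := hq
      exact hdeg h
  let a := S₁.equivFin.symm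
  let b := S₂.equivFin.symm
  exact ⟨{
    s := S₁.card
    t := S₂.card
    γ := fun i => γ (a i)
    A := fun i => E (a i)
    re := fun j => x (b j)
    im := fun j => y (b j)
    B := fun j => B (b j)
    γ_ne_zero := fun i => hγ0 _
    γ_injective := fun i j h => a.injective (Subtype.ext (by
      have h' : γ (a i) = γ (a j) := h
      rw [hγ, hγ, h']))
    im_pos := fun j => hy _
    re_im_injective := fun i j h => b.injective (Subtype.ext (by
      obtain ⟨h1, h2⟩ := Prod.mk.inj h
      rw [hxy, hxy, h1, h2]))
    A_ne_zero := fun i => hE0 _ (hm₁ _)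
    B_ne_zero := fun j h => hE0 _ (hm₂ (b j)) (by
      have := hBB (b j)
      rwa [h, zero_pow two_ne_zero, eq_comm, neg_eq_zero] at this)
    A_mul_self := fun i => hE _ (hm₁ _)
    A_mul_A := fun i j h => hEE _ (hm₁ _) _ (hm₁ _)
      fun h' => h (a.injective (Subtype.ext h'))
    A_mul_B := fun i j => hEB _ _ (hm₁ _) (hne _ _)
    B_mul_A := fun i j => hBE' _ _ (hm₁ _) (hne _ _)
    B_mul_B := fun j l h => by
      rw [← hBE (b l), ← mul_assoc, hBE' _ _ (hm₂ _)
        fun h' => h (b.injective (Subtype.ext h'.symm)), zero_mul]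
    B_pow_three := fun j => by
      rw [pow_succ, hBB, neg_mul, hBE]
    decomposition := by
      rw [Equiv.sum_comp a fun p => γ p • E p, Equiv.sum_comp b fun p => x p • B p ^ 2,
        Equiv.sum_comp b fun p => y p • B p]
      conv_lhs => rw [hsum]
      rw [Finset.sum_add_distrib, Finset.sum_neg_distrib]
      abel }⟩

end Existence

/-! ### Convergence of the scalar series. -/

section Convergence

namespace NormalizedFineFrobenius

variable {K : Type*} [NormedField K] [LinearOrder K] {n : ℕ}
  {M : Matrix (Fin n) (Fin n) K} {f : PowerSeries K} (D : NormalizedFineFrobenius M)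

theorem summable_γ₀ (hMf : M ∈ OmegaSet n f) (i : Fin (D.s + 1)) :
    Summable fun m : ℕ =>
      algebraMap K (ValuedCompletion K) (PowerSeries.coeff m f * D.γ₀ i ^ m) := by
  cases i using Fin.cases with
  | zero =>
    -- At `γ_0 = 0` only the constant term survives.
    refine summable_of_ne_finset_zero (s := {0}) fun m hm => ?_
    have hm' : m ≠ 0 := by simpa using hm
    simp [γ₀, hm']
  | succ i =>
    refine summable_coeff_mul (norm_nonneg (D.γ i)) (lt_of_le_of_lt ?_ hMf)
      fun m => (norm_pow _ m).le
    rw [← closureAbs_algebraMap_base]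
    exact le_iSup₂_of_le _ (D.isEigenvalueOf_γ i) le_rfl

/-- Here `H(λ_j) = x_j` and `|V(λ_j)| = |√-1 y_j| = |y_j|`, so membership in `OmegaHatSet` bounds
exactly the base of the estimates for `powParts`. -/
theorem summable_powParts [IsStrictOrderedRing K] {I : CompletionClosure K} (hI : I ^ 2 = -1)
    (hMf : M ∈ OmegaHatSet n f) (j : Fin D.t) :
    (Summable fun m : ℕ => algebraMap K (ValuedCompletion K)
      (PowerSeries.coeff m f * (powParts (D.re j) (D.im j) m).1)) ∧
    Summable fun m : ℕ => algebraMap K (ValuedCompletion K)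
      (PowerSeries.coeff m f * (powParts (D.re j) (D.im j) m).2) := by
  have h := hMf.2 _ (D.isEigenvalueOf_eigen hI j)
  have hF := algebraMap_ne_sqrt_neg_one (F := K) hI
  unfold eigen at h
  rw [horizontalPart_add_sqrt_neg_one_mul hI hF (D.im_pos j).ne',
    verticalPart_add_sqrt_neg_one_mul hI hF (D.im_pos j).ne',
    IsScalarTower.algebraMap_apply K (ValuedCompletion K) (CompletionClosure K) (D.im j),
    closureAbs_sqrt_neg_one_mul hI, norm_algebraMap'] at h
  by_cases hna : IsNonarchimedean fun x : K => ‖x‖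
  · have hb := norm_powParts_le_of_isNonarchimedean hna (D.re j) (D.im j)
    have h0 : 0 ≤ max ‖D.re j‖ ‖D.im j‖ := le_max_of_le_left (norm_nonneg _)
    exact ⟨summable_coeff_mul h0 (h.2 hna) fun m => (hb m).1,
      summable_coeff_mul h0 (h.2 hna) fun m => (hb m).2⟩
  · have hb := norm_powParts_le (D.re j) (D.im j)
    have h0 : 0 ≤ ‖D.re j‖ + ‖D.im j‖ := by positivity
    exact ⟨summable_coeff_mul h0 (h.1 hna) fun m => (hb m).1,
      summable_coeff_mul h0 (h.1 hna) fun m => (hb m).2⟩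

/-- The matrices on the right do not depend on `m`, so summing `f(M)` only requires summing the
scalar coefficients. -/
theorem coeff_smul_toCompletion_pow (m : ℕ) :
    algebraMap K (ValuedCompletion K) (PowerSeries.coeff m f) • toCompletion M ^ m =
      ∑ i, algebraMap K (ValuedCompletion K) (PowerSeries.coeff m f * D.γ₀ i ^ m) •
          toCompletion (D.A₀ i)
        - ∑ j, algebraMap K (ValuedCompletion K)
            (PowerSeries.coeff m f * (powParts (D.re j) (D.im j) m).1) • toCompletion (D.B j) ^ 2
        + ∑ j, algebraMap K (ValuedCompletion K)
            (PowerSeries.coeff m f * (powParts (D.re j) (D.im j) m).2) • toCompletion (D.B j) := by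
  have hpow : ∀ (N : Matrix (Fin n) (Fin n) K) (k : ℕ), toCompletion N ^ k = toCompletion (N ^ k) :=
    fun N k => (map_pow (algebraMap K (ValuedCompletion K)).mapMatrix N k).symm
  simp only [hpow]
  rw [D.pow_eq m]
  ext a b
  simp only [toCompletion, Matrix.smul_apply, Matrix.add_apply, Matrix.sub_apply,
    Matrix.sum_apply, Matrix.map_apply, smul_eq_mul, map_add, map_sub, map_sum, map_mul, mul_add,
    mul_sub, Finset.mul_sum, mul_assoc]

end NormalizedFineFrobenius

end Convergence

/-! ### Proof of the proposition. -/

theorem mainTheorem7 {K : Type*} [NormedField K] [LinearOrder K] [IsStrictOrderedRing K]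
    (hK : IsOrderedQuadraticallyClosed K)
    (I : CompletionClosure K) (hI : I ^ 2 = -1)
    (f : PowerSeries K) {n : ℕ} (M : Matrix (Fin n) (Fin n) K)
    (hM : M ≠ 0) (hMf : M ∈ OmegaHatSet n f)
    (hss : IsSemisimpleMatrix M) (hsb : matSplittingBound M ≤ 2) :
    Nonempty (NormalizedFineFrobenius M) ∧
    ∀ D : NormalizedFineFrobenius M,
      (∀ z : CompletionClosure K, z ≠ 0 →
        (IsEigenvalueOf M z ↔
          (∃ i, z = algebraMap K (CompletionClosure K) (D.γ i)) ∨
          (∃ j, z = D.eigen I j ∨ z = D.eigenConj I j))) ∧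
      ∃ (F : Fin (D.s + 1) → ValuedCompletion K) (R J : Fin D.t → ValuedCompletion K),
        (∀ i, HasSum
          (fun m : ℕ => algebraMap K (ValuedCompletion K) (PowerSeries.coeff m f * D.γ₀ i ^ m))
          (F i)) ∧
        (∀ j, SeriesConvergesTo (reTerm f (D.eigen I j))
          (algebraMap (ValuedCompletion K) (CompletionClosure K) (R j))) ∧
        (∀ j, SeriesConvergesTo (imTerm I f (D.eigen I j))
          (algebraMap (ValuedCompletion K) (CompletionClosure K) (J j))) ∧
        (∀ j, SeriesConvergesTo (powTerm f (D.eigen I j))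
          (algebraMap (ValuedCompletion K) (CompletionClosure K) (R j) +
            I * algebraMap (ValuedCompletion K) (CompletionClosure K) (J j))) ∧
        HasSum
          (fun m : ℕ => algebraMap K (ValuedCompletion K) (PowerSeries.coeff m f) •
            toCompletion M ^ m)
          (∑ i, F i • toCompletion (D.A₀ i)
            - ∑ j, R j • toCompletion (D.B j) ^ 2
            + ∑ j, J j • toCompletion (D.B j)) := by
  refine ⟨nonempty_normalizedFineFrobenius hK hss hsb, fun D =>
    ⟨fun z hz => D.isEigenvalueOf_iff_eq hI hz, ?_⟩⟩
  have hF := algebraMap_ne_sqrt_neg_one (F := K) hI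
  have hSγ := D.summable_γ₀ hMf.1
  have hSP := D.summable_powParts hI hMf
  have hbase : ∀ a : K, algebraMap K (CompletionClosure K) a =
      algebraMap (ValuedCompletion K) (CompletionClosure K)
        (algebraMap K (ValuedCompletion K) a) :=
    IsScalarTower.algebraMap_apply K (ValuedCompletion K) (CompletionClosure K)
  refine ⟨_, fun j => ∑' m : ℕ, algebraMap K (ValuedCompletion K)
      (PowerSeries.coeff m f * (powParts (D.re j) (D.im j) m).1),
    fun j => ∑' m : ℕ, algebraMap K (ValuedCompletion K)
      (PowerSeries.coeff m f * (powParts (D.re j) (D.im j) m).2),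
    fun i => (hSγ i).hasSum, fun j => ?_, fun j => ?_, fun j => ?_, ?_⟩
  · convert seriesConvergesTo_algebraMap (hSP j).1.hasSum using 2 with m
    rw [NormalizedFineFrobenius.eigen,
      reTerm_add_sqrt_neg_one_mul hI hF (D.im_pos j).ne', hbase]
  · convert seriesConvergesTo_algebraMap (hSP j).2.hasSum using 2 with m
    rw [NormalizedFineFrobenius.eigen,
      imTerm_add_sqrt_neg_one_mul hI hF (D.im_pos j).ne', hbase]
  · convert seriesConvergesTo_add_sqrt_neg_one_mul hI (hSP j).1.hasSum (hSP j).2.hasSum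
      using 2 with m
    rw [NormalizedFineFrobenius.eigen, powTerm_add_sqrt_neg_one_mul hI, hbase, hbase]
  · simp only [D.coeff_smul_toCompletion_pow]
    exact ((hasSum_sum fun i _ => (hSγ i).hasSum.smul_const _).sub
      (hasSum_sum fun j _ => (hSP j).1.hasSum.smul_const _)).add
      (hasSum_sum fun j _ => (hSP j).2.hasSum.smul_const _)
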